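/- For a positive integer $n$ let $f(n)$ denote the number of unordered factorizations of $n$ into factors larger than $1$, that is, the number of tuples $(n_1,\dots,n_r)$ of integers with $1<n_1\le n_2\le\dots\le n_r$ and $n=n_1n_2\cdots n_r$ (the empty tuple being counted for $n=1$). For real $x\ge 1$ let $\mathscr{F}(x)=\{f(n): n\ge 1,\ f(n)\le x\}$ be the set of values of $f$ not exceeding $x$, and let $C=2\pi\sqrt{2/3}$. Then there is a function $E$ with $E(x)=O\left(\frac{\log\log\log x}{\log\log x}\right)$ as $x\to\infty$ such that, for all sufficiently large $x$, $$\#\mathscr{F}(x)\le\exp\left(C\sqrt{\frac{\log x}{\log\log x}}\,\bigl(1+E(x)\bigr)\right).$$ -/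

import Mathlib

/-- The unordered factorizations of `n` into factors larger than `1`, as multisets of factors.
The empty multiset is the unique factorization of `1`. -/
def unorderedFactorizations (n : ℕ) : Set (Multiset ℕ) :=
  {s | (∀ a ∈ s, 1 < a) ∧ s.prod = n}

/-- A positive integer has only finitely many unordered factorizations, so that the cardinality
below is a genuine one. -/
theorem unorderedFactorizations_finite {n : ℕ} (hn : 0 < n) :
    (unorderedFactorizations n).Finite := by
  refine (Set.finite_Iic (n • (Finset.range (n + 1)).val)).subset ?_
  rintro s ⟨h1, h2⟩
  have key : ∀ t : Multiset ℕ, (∀ a ∈ t, 1 < a) → t.card ≤ t.prod := by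
    intro t
    induction t using Multiset.induction_on with
    | empty => simp
    | cons a t ih =>
      intro h
      have ha : 1 < a := h a (Multiset.mem_cons_self a t)
      have ht : ∀ b ∈ t, 1 < b := fun b hb => h b (Multiset.mem_cons_of_mem hb)
      have hpos : 0 < t.prod :=
        Nat.pos_of_ne_zero (Multiset.prod_ne_zero fun h0 => absurd (ht 0 h0) (by omega))
      have := ih ht
      rw [Multiset.card_cons, Multiset.prod_cons]
      nlinarith
  rw [Set.mem_Iic, Multiset.le_iff_count]
  intro a
  by_cases ha : a ∈ s
  · have hle : a ≤ n := Nat.le_of_dvd hn (h2 ▸ Multiset.dvd_prod ha)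
    have hc : (Finset.range (n + 1)).val.count a = 1 :=
      Multiset.count_eq_one_of_mem (Finset.range (n + 1)).nodup (Finset.mem_range.mpr (Nat.lt_succ_of_le hle))
    rw [Multiset.count_nsmul, hc, mul_one]
    exact (Multiset.count_le_card a s).trans ((key s h1).trans h2.le)
  · simp [Multiset.count_eq_zero_of_notMem ha]

/-- `numFactorizations n` is `f(n)`, the number of unordered factorizations of `n` into factors
larger than `1`. -/
noncomputable def numFactorizations (n : ℕ) : ℕ :=
  (unorderedFactorizations n).ncard

/-- `factorizationValues x` is `𝓕(x)`, the set of values `f(n)`, `n` a positive integer, that do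
not exceed `x`. -/
def factorizationValues (x : ℝ) : Set ℕ :=
  {m | ∃ n : ℕ, 0 < n ∧ numFactorizations n = m ∧ (m : ℝ) ≤ x}

/-- The set of values not exceeding `x` is finite. -/
theorem factorizationValues_finite (x : ℝ) : (factorizationValues x).Finite := by
  refine (Set.finite_Iic ⌊x⌋₊).subset ?_
  rintro m ⟨n, -, -, hm⟩
  exact Nat.le_floor hm

/-! Renaming primes preserves `f`, so `f n` depends only on the multiset of exponents of `n`, and it
suffices to count the multisets that can occur with `f n ≤ x`. An exponent `a` can be spread over
`r` ordered slots in `(r + a - 1).choose a` ways, and forgetting the order merges at most `r!`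
tuples. Hence `f n ≤ x` forces the product of these binomials to be at most `B = r! * x`
(`prod_choose_le_factorial_mul_numFactorizations`).

Rankin's method bounds the number of such multisets by `B ^ s * ∏ (1 - q c)⁻¹`, where `q c` is the
binomial for the exponent `c` to the power `-s` (`ncard_factorizationValues_le`). If the binomial is
at least `exp (w * c)` on the relevant range, the product is essentially the partition generating
function at `exp (-s * w)`, with logarithm at most `π ^ 2 / (6 * s * w)`.

Put `L = log log x` and `r ≈ log x / L ^ 2`, so that `log B` is close to `log x`. Optimizing `s`
gives the exponent `2 * π * √(log x / (6 * w))`, which is the claimed main term when `w = L / 4`.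
Here `w = 0.3 * L` is available, and the surplus absorbs every error, so `E = 0` works. -/

/-! ### Dependence on the exponents only. -/

/-- Functions on finite types whose fibres have equal cardinalities differ by an equivalence. -/
theorem exists_equiv_of_card_fiber_eq {α β γ : Type*} [Fintype α] [Fintype β] [DecidableEq γ]
    (f : α → γ) (g : β → γ)
    (h : ∀ c, (Finset.univ.filter fun a => f a = c).card =
      (Finset.univ.filter fun b => g b = c).card) :
    ∃ e : α ≃ β, ∀ a, g (e a) = f a := by
  have h' : ∀ c, Nonempty ({a // f a = c} ≃ {b // g b = c}) := fun c => by
    refine ⟨Fintype.equivOfCardEq ?_⟩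
    rw [Fintype.card_subtype, Fintype.card_subtype, h c]
  exact ⟨Equiv.ofFiberEquiv fun c => (h' c).some, Equiv.ofFiberEquiv_map _⟩

/-- The number of primes that divide `n` to the exact power `c`. -/
def exponentMultiplicity (n c : ℕ) : ℕ :=
  (n.primeFactors.filter fun p => n.factorization p = c).card

/-- The completely multiplicative map of `ℕ` given by its values at primes. -/
noncomputable def primeRelabeling (g : ℕ → ℕ) : ℕ →*₀ ℕ where
  -- The case `n = 0` is needed because the factorization of `0` is empty and the product would be
  -- `1`.
  toFun n := if n = 0 then 0 else n.factorization.prod fun p k => g p ^ k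
  map_zero' := by simp
  map_one' := by simp
  map_mul' a b := by
    by_cases ha : a = 0
    · simp [ha]
    by_cases hb : b = 0
    · simp [hb]
    simp only [ha, hb, mul_eq_zero, or_self, if_false]
    rw [Nat.factorization_mul ha hb, Finsupp.prod_add_index' (by simp) (by simp [pow_add])]

theorem primeRelabeling_apply (g : ℕ → ℕ) {n : ℕ} (hn : n ≠ 0) :
    primeRelabeling g n = n.factorization.prod fun p k => g p ^ k := by
  simp [primeRelabeling, hn]

theorem primeRelabeling_prime (g : ℕ → ℕ) {p : ℕ} (hp : p.Prime) :
    primeRelabeling g p = g p := by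
  rw [primeRelabeling_apply g hp.ne_zero, hp.factorization, Finsupp.prod_single_index (by simp),
    pow_one]

theorem primeRelabeling_leftInverse {g h : ℕ → ℕ} {n : ℕ} (hn : n ≠ 0)
    (hg : ∀ p ∈ n.primeFactors, (g p).Prime) (hh : ∀ p ∈ n.primeFactors, h (g p) = p)
    {d : ℕ} (hd : d ∣ n) : primeRelabeling h (primeRelabeling g d) = d := by
  have hd0 : d ≠ 0 := fun h0 => hn (by simpa [h0] using hd)
  rw [primeRelabeling_apply g hd0, Finsupp.prod, map_prod]
  conv_rhs => rw [← Nat.prod_factorization_pow_eq_self hd0, Finsupp.prod]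
  refine Finset.prod_congr rfl fun p hp => ?_
  have hp' : p ∈ n.primeFactors := Nat.primeFactors_mono hd hn hp
  rw [map_pow, primeRelabeling_prime h (hg p hp'), hh p hp']

/-- Relabeling primes along `e` carries factorizations of `n` to factorizations of `m`; relabeling
back undoes this on divisors of `n`, which gives injectivity. -/
theorem numFactorizations_le_of_equiv {n m : ℕ} (hn : 0 < n) (hm : 0 < m)
    (e : n.primeFactors ≃ m.primeFactors)
    (he : ∀ p, m.factorization (e p) = n.factorization p) :
    numFactorizations n ≤ numFactorizations m := by
  let g : ℕ → ℕ := fun p => if hp : p ∈ n.primeFactors then e ⟨p, hp⟩ else p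
  let h : ℕ → ℕ := fun q => if hq : q ∈ m.primeFactors then e.symm ⟨q, hq⟩ else q
  have hgval : ∀ p (hp : p ∈ n.primeFactors), g p = e ⟨p, hp⟩ := fun p hp => dif_pos hp
  have hg : ∀ p ∈ n.primeFactors, (g p).Prime := fun p hp => by
    rw [hgval p hp]; exact Nat.prime_of_mem_primeFactors (e ⟨p, hp⟩).2
  have hh : ∀ p ∈ n.primeFactors, h (g p) = p := fun p hp => by
    rw [hgval p hp]
    exact (dif_pos (e ⟨p, hp⟩).2).trans (congrArg Subtype.val (e.symm_apply_apply ⟨p, hp⟩))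
  have hinv : ∀ d, d ∣ n → primeRelabeling h (primeRelabeling g d) = d := fun d hd =>
    primeRelabeling_leftInverse hn.ne' hg hh hd
  have hgn : primeRelabeling g n = m := by
    rw [primeRelabeling_apply g hn.ne']
    conv_rhs => rw [← Nat.prod_factorization_pow_eq_self hm.ne']
    rw [Finsupp.prod, Finsupp.prod, Nat.support_factorization, Nat.support_factorization,
      ← Finset.prod_coe_sort n.primeFactors, ← Finset.prod_coe_sort m.primeFactors]
    refine Fintype.prod_equiv e _ _ fun p => ?_
    rw [he p, hgval p p.2]
  refine Set.ncard_le_ncard_of_injOn (Multiset.map (primeRelabeling g)) ?_ ?_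
    (unorderedFactorizations_finite hm)
  · rintro s ⟨h1, rfl⟩
    refine ⟨fun b hb => ?_, by rw [← map_multiset_prod, hgn]⟩
    obtain ⟨a, ha, rfl⟩ := Multiset.mem_map.mp hb
    have ha1 := h1 a ha
    have hia := hinv a (Multiset.dvd_prod ha)
    -- A factor sent to `0` or `1` would be sent back to `0` or `1`, not to `a`.
    by_contra hlt
    have : primeRelabeling g a = 0 ∨ primeRelabeling g a = 1 := by omega
    rcases this with h0 | h0 <;> rw [h0] at hia <;> simp at hia <;> omega
  · have hs : ∀ s ∈ unorderedFactorizations n,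
        (s.map (primeRelabeling g)).map (primeRelabeling h) = s := by
      rintro s ⟨-, rfl⟩
      rw [Multiset.map_map]
      conv_rhs => rw [← Multiset.map_id s]
      exact Multiset.map_congr rfl fun a ha => hinv a (Multiset.dvd_prod ha)
    intro s hs1 t ht1 hst
    rw [← hs s hs1, ← hs t ht1]
    exact congrArg _ hst

/-- The number of unordered factorizations depends only on the multiset of exponents. -/
theorem numFactorizations_eq_of_exponentMultiplicity {n m : ℕ} (hn : 0 < n) (hm : 0 < m)
    (h : exponentMultiplicity n = exponentMultiplicity m) :
    numFactorizations n = numFactorizations m := by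
  have hcard : ∀ (k c : ℕ), (Finset.univ.filter fun p : k.primeFactors =>
      k.factorization p = c).card = exponentMultiplicity k c := fun k c => by
    rw [exponentMultiplicity, Finset.univ_eq_attach,
      Finset.filter_attach (fun p => k.factorization p = c), Finset.card_map, Finset.card_attach]
  obtain ⟨e, he⟩ := exists_equiv_of_card_fiber_eq
    (fun p : n.primeFactors => n.factorization p) (fun p : m.primeFactors => m.factorization p)
    fun c => by rw [hcard, hcard, h]
  refine le_antisymm (numFactorizations_le_of_equiv hn hm e he)
    (numFactorizations_le_of_equiv hm hn e.symm fun q => ?_)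
  rw [← he (e.symm q), e.apply_symm_apply]

/-! ### Ordered versus unordered factorizations. -/

/-- At most `r!` tuples of length `r` give the same multiset of entries different from `1`. -/
theorem card_filter_map_ne_one_le {r : ℕ} (V : Finset (Fin r → ℕ)) (s : Multiset ℕ) :
    (V.filter fun v => (Finset.univ.val.map v).filter (· ≠ 1) = s).card ≤ r.factorial := by
  rcases (V.filter fun v => (Finset.univ.val.map v).filter (· ≠ 1) = s).eq_empty_or_nonempty
    with h0 | ⟨v, hv⟩
  · rw [h0]; exact Nat.zero_le _
  have hv' := (Finset.mem_filter.mp hv).2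
  have hr : Fintype.card (Equiv.Perm (Fin r)) = r.factorial := by
    rw [Fintype.card_perm, Fintype.card_fin]
  rw [← hr, ← Finset.card_univ]
  refine (Finset.card_le_card (t := Finset.univ.image fun σ : Equiv.Perm (Fin r) => v ∘ σ)
    fun w hw => ?_).trans Finset.card_image_le
  have hw' := (Finset.mem_filter.mp hw).2
  have hcount : ∀ (u : Fin r → ℕ) (c : ℕ),
      (Finset.univ.val.map u).count c = (Finset.univ.filter fun i => u i = c).card := by
    intro u c
    rw [Multiset.count_map, Finset.card_def, Finset.filter_val]
    simp only [eq_comm]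
  have hne : ∀ c, c ≠ 1 → (Finset.univ.filter fun i => w i = c).card =
      (Finset.univ.filter fun i => v i = c).card := by
    intro c hc
    rw [← hcount, ← hcount, ← Multiset.count_filter_of_pos (p := (· ≠ 1)) hc, hw', ← hv',
      Multiset.count_filter_of_pos (p := (· ≠ 1)) hc]
  -- The entries `1` were discarded, but the fixed length `r` recovers their number, so `w` is a
  -- permutation of `v`.
  have hone : (Finset.univ.filter fun i => w i = 1).card =
      (Finset.univ.filter fun i => v i = 1).card := by
    have hsplit : ∀ u : Fin r → ℕ, (Finset.univ.filter fun i => u i = 1).card +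
        ((Finset.univ.val.map u).filter (· ≠ 1)).card = r := by
      intro u
      rw [← hcount, Multiset.count_eq_card_filter_eq, ← Multiset.card_add]
      simp only [eq_comm (a := 1)]
      rw [Multiset.filter_add_not]
      simp
    have h1 := hsplit w
    have h2 := hsplit v
    rw [hw'] at h1
    rw [hv'] at h2
    omega
  obtain ⟨e, he⟩ := exists_equiv_of_card_fiber_eq w v fun c => by
    by_cases hc : c = 1
    · rw [hc, hone]
    · exact hne c hc
  exact Finset.mem_image.mpr ⟨e, Finset.mem_univ _, funext he⟩

/-- There are at least `∏ C(r + a - 1, a)` ordered factorizations into `r` positive factors, the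
product being over the exponents `a` of `n`, and each unordered one arises from at most `r!`. -/
theorem prod_choose_le_factorial_mul_numFactorizations {n : ℕ} (hn : 0 < n) (r : ℕ) :
    ∏ p ∈ n.primeFactors, (r + n.factorization p - 1).choose (n.factorization p) ≤
      r.factorial * numFactorizations n := by
  classical
  -- For each prime, a multiset of slots: the multiplicity of `i` is the exponent of `p` in the
  -- `i`-th factor.
  let H := (p : n.primeFactors) → Sym (Fin r) (n.factorization p)
  let v : H → Fin r → ℕ := fun h i =>
    ∏ p : n.primeFactors, (p : ℕ) ^ (h p : Multiset (Fin r)).count i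
  have hpp : ∀ p : n.primeFactors, (p : ℕ).Prime := fun p => Nat.prime_of_mem_primeFactors p.2
  have hcard : Fintype.card H =
      ∏ p ∈ n.primeFactors, (r + n.factorization p - 1).choose (n.factorization p) := by
    rw [Fintype.card_pi, ← Finset.prod_coe_sort n.primeFactors]
    exact Finset.prod_congr rfl fun p _ => by rw [Sym.card_sym_eq_choose, Fintype.card_fin]
  have hfac : ∀ (h : H) (i : Fin r) (p : n.primeFactors),
      (v h i).factorization p = (h p : Multiset (Fin r)).count i := by
    intro h i p
    simp only [v]
    rw [Nat.factorization_prod fun q _ => pow_ne_zero _ (hpp q).ne_zero, Finset.sum_apply']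
    rw [Finset.sum_eq_single p]
    · rw [(hpp p).factorization_pow, Finsupp.single_eq_same]
    · intro q _ hq
      rw [(hpp q).factorization_pow, Finsupp.single_eq_of_ne]
      exact fun h => hq (Subtype.ext h.symm)
    · simp
  have hinj : Function.Injective v := by
    intro h k hv
    funext p
    refine Subtype.ext (Multiset.ext.mpr fun i => ?_)
    exact (hfac h i p).symm.trans ((congrArg (fun u => (u i).factorization p) hv).trans
      (hfac k i p))
  have hprod : ∀ h : H, ∏ i, v h i = n := by
    intro h
    simp only [v]
    rw [Finset.prod_comm]
    conv_rhs => rw [← Nat.prod_factorization_pow_eq_self hn.ne', Finsupp.prod,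
      Nat.support_factorization, ← Finset.prod_coe_sort]
    refine Finset.prod_congr rfl fun p _ => ?_
    rw [Finset.prod_pow_eq_pow_sum]
    congr 1
    rw [Multiset.sum_count_eq_card (fun a _ => Finset.mem_univ a)]
    exact (h p).2
  rw [← hcard, ← Finset.card_univ, ← Finset.card_image_of_injective _ hinj, numFactorizations,
    Set.ncard_eq_toFinset_card _ (unorderedFactorizations_finite hn)]
  refine Finset.card_le_mul_card_image_of_maps_to
    (f := fun u : Fin r → ℕ => (Finset.univ.val.map u).filter (· ≠ 1)) ?_ _
    fun s _ => card_filter_map_ne_one_le _ s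
  intro u hu
  obtain ⟨h, -, rfl⟩ := Finset.mem_image.mp hu
  rw [Set.Finite.mem_toFinset]
  refine ⟨fun a ha => ?_, ?_⟩
  · obtain ⟨ha, ha1⟩ := Multiset.mem_filter.mp ha
    obtain ⟨i, -, rfl⟩ := Multiset.mem_map.mp ha
    have : 0 < v h i := Finset.prod_pos fun p _ => pow_pos (hpp p).pos _
    omega
  · have h1 : ∀ t : Multiset ℕ, (t.filter (· ≠ 1)).prod = t.prod := by
      intro t
      induction t using Multiset.induction_on with
      | empty => simp
      | cons a t ih => by_cases ha : a = 1 <;> simp [ha, ih]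
    rw [h1]
    exact hprod h

/-! ### The partition generating function. -/

/-- The finite form of the Euler product for partitions. -/
theorem sum_prod_pow_le_prod_inv_one_sub (S : Finset (ℕ → ℕ)) (I : Finset ℕ)
    (hS : ∀ σ ∈ S, ∀ c, c ∉ I → σ c = 0) (q : ℕ → ℝ) (hq0 : ∀ c ∈ I, 0 ≤ q c)
    (hq1 : ∀ c ∈ I, q c < 1) :
    ∑ σ ∈ S, ∏ c ∈ I, q c ^ σ c ≤ ∏ c ∈ I, (1 - q c)⁻¹ := by
  classical
  let K : ℕ := S.sup fun σ => I.sup σ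
  have hK : ∀ σ ∈ S, ∀ c ∈ I, σ c ≤ K := fun σ hσ c hc =>
    (Finset.le_sup (f := σ) hc).trans (Finset.le_sup (f := fun σ : ℕ → ℕ => I.sup σ) hσ)
  let F : (ℕ → ℕ) → (∀ c ∈ I, ℕ) := fun σ c _ => σ c
  have hF : Set.InjOn F S := by
    intro σ hσ τ hτ h
    funext c
    by_cases hc : c ∈ I
    · exact congrFun (congrFun h c) hc
    · rw [hS σ hσ c hc, hS τ hτ c hc]
  calc ∑ σ ∈ S, ∏ c ∈ I, q c ^ σ c
      = ∑ σ ∈ S, ∏ c ∈ I.attach, q c.1 ^ F σ c.1 c.2 :=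
        Finset.sum_congr rfl fun σ _ => (Finset.prod_attach I fun c => q c ^ σ c).symm
    _ = ∑ φ ∈ S.image F, ∏ c ∈ I.attach, q c.1 ^ φ c.1 c.2 := by rw [Finset.sum_image hF]
    _ ≤ ∑ φ ∈ I.pi fun _ => Finset.range (K + 1), ∏ c ∈ I.attach, q c.1 ^ φ c.1 c.2 := by
        refine Finset.sum_le_sum_of_subset_of_nonneg ?_ fun φ _ _ =>
          Finset.prod_nonneg fun c _ => pow_nonneg (hq0 c c.2) _
        intro φ hφ
        obtain ⟨σ, hσ, rfl⟩ := Finset.mem_image.mp hφ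
        exact Finset.mem_pi.mpr fun c hc =>
          Finset.mem_range.mpr (Nat.lt_succ_of_le (hK σ hσ c hc))
    _ = ∏ c ∈ I, ∑ k ∈ Finset.range (K + 1), q c ^ k :=
        (Finset.prod_sum I (fun _ => Finset.range (K + 1)) fun c k => q c ^ k).symm
    _ ≤ ∏ c ∈ I, (1 - q c)⁻¹ := by
        refine Finset.prod_le_prod
          (fun c hc => Finset.sum_nonneg fun k _ => pow_nonneg (hq0 c hc) k) fun c hc => ?_
        rw [← tsum_geometric_of_lt_one (hq0 c hc) (hq1 c hc)]
        exact (summable_geometric_of_lt_one (hq0 c hc) (hq1 c hc)).sum_le_tsum _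
          fun k _ => pow_nonneg (hq0 c hc) k

theorem sum_exp_neg_mul_le {u : ℝ} (hu : 0 < u) (T : ℕ) :
    ∑ c ∈ Finset.Icc 1 T, Real.exp (-u * c) ≤ 1 / u := by
  have hlt : Real.exp (-u) < 1 := by simpa using hu
  have h0 : 0 ≤ Real.exp (-u) := (Real.exp_pos _).le
  have hs : HasSum (fun k : ℕ => Real.exp (-u) * Real.exp (-u) ^ k)
      (Real.exp (-u) * (1 - Real.exp (-u))⁻¹) := (hasSum_geometric_of_lt_one h0 hlt).mul_left _
  calc ∑ c ∈ Finset.Icc 1 T, Real.exp (-u * c)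
      = ∑ k ∈ Finset.range T, Real.exp (-u) * Real.exp (-u) ^ k := by
        rw [← Finset.Ico_add_one_right_eq_Icc, Finset.sum_Ico_eq_sum_range, Nat.add_sub_cancel]
        refine Finset.sum_congr rfl fun k _ => ?_
        rw [← Real.exp_nat_mul, ← Real.exp_add]
        congr 1
        push_cast
        ring
    _ ≤ Real.exp (-u) * (1 - Real.exp (-u))⁻¹ :=
        sum_le_hasSum _ (fun k _ => mul_nonneg h0 (pow_nonneg h0 k)) hs
    _ ≤ 1 / u := by
        rw [← div_eq_mul_inv, div_le_div_iff₀ (by linarith) hu]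
        have := Real.add_one_le_exp u
        have h1 : Real.exp (-u) * Real.exp u = 1 := by rw [← Real.exp_add]; simp
        nlinarith [Real.exp_pos (-u)]

/-- The logarithm of the generating function of partitions at `exp (-t)` is at most
`π ^ 2 / (6 * t)`. -/
theorem sum_neg_log_one_sub_exp_le {t : ℝ} (ht : 0 < t) (T : ℕ) :
    ∑ c ∈ Finset.Icc 1 T, -Real.log (1 - Real.exp (-t * c)) ≤ Real.pi ^ 2 / (6 * t) := by
  -- Expanding the logarithm and summing over `c` first gives `∑ₖ (1/k) ∑_c exp (-t * k * c) ≤ ∑ₖ 1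
  -- / (t * k ^ 2)`, which is `ζ(2) / t`.
  have h1 : HasSum (fun k : ℕ => ∑ c ∈ Finset.Icc 1 T, Real.exp (-t * c) ^ (k + 1) / ((k : ℝ) + 1))
      (∑ c ∈ Finset.Icc 1 T, -Real.log (1 - Real.exp (-t * c))) := by
    refine hasSum_sum fun c hc => ?_
    refine Real.hasSum_pow_div_log_of_abs_lt_one ?_
    rw [abs_of_pos (Real.exp_pos _), Real.exp_lt_one_iff]
    have : (0 : ℝ) < c := by exact_mod_cast (Finset.mem_Icc.mp hc).1
    nlinarith
  have h2 : HasSum (fun k : ℕ => 1 / t * (1 / ((k : ℝ) + 1) ^ 2)) (1 / t * (Real.pi ^ 2 / 6)) := by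
    refine HasSum.mul_left _ ?_
    have := (hasSum_nat_add_iff' 1).mpr hasSum_zeta_two
    simpa using this
  refine (hasSum_le (fun k => ?_) h1 h2).trans (le_of_eq (by field_simp))
  have hk : (0 : ℝ) < (k : ℝ) + 1 := by positivity
  rw [← Finset.sum_div]
  have h3 := sum_exp_neg_mul_le (mul_pos ht hk) T
  have h4 : ∀ c ∈ Finset.Icc 1 T, Real.exp (-t * c) ^ (k + 1) =
      Real.exp (-(t * ((k : ℝ) + 1)) * c) := fun c _ => by
    rw [← Real.exp_nat_mul]; congr 1; push_cast; ring
  rw [Finset.sum_congr rfl h4]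
  calc _ ≤ 1 / (t * ((k : ℝ) + 1)) / ((k : ℝ) + 1) := by gcongr
    _ = _ := by field_simp

theorem neg_log_one_sub_le {q : ℝ} (hq0 : 0 ≤ q) (hq : q ≤ 1 / 2) :
    -Real.log (1 - q) ≤ 2 * q := by
  have h := Real.one_sub_inv_le_log_of_pos (show 0 < 1 - q by linarith)
  have h2 : (1 - q)⁻¹ ≤ 1 + 2 * q := by
    rw [inv_le_comm₀ (by linarith) (by linarith), inv_le_iff_one_le_mul₀ (by linarith)]
    nlinarith
  linarith

/-- The geometric decay of `q` is only assumed up to the cutoff `T`. Beyond it, each of the at most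
`M` terms costs `2 * exp (-t * T)`. -/
theorem sum_neg_log_one_sub_le {q : ℕ → ℝ} {t : ℝ} {M T : ℕ} (ht : 0 < t)
    (hq0 : ∀ c, 0 ≤ q c) (hq : ∀ c, 1 ≤ c → q c ≤ Real.exp (-t * (min c T : ℕ)))
    (hT : Real.exp (-t * T) ≤ 1 / 2) :
    ∑ c ∈ Finset.Icc 1 M, -Real.log (1 - q c) ≤
      Real.pi ^ 2 / (6 * t) + M * (2 * Real.exp (-t * T)) := by
  have hterm : ∀ c ∈ Finset.Icc 1 M, -Real.log (1 - q c) ≤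
      (if c ≤ T then -Real.log (1 - Real.exp (-t * c)) else 0) + 2 * Real.exp (-t * T) := by
    intro c hc
    have hc1 := (Finset.mem_Icc.mp hc).1
    have h := hq c hc1
    split_ifs with hcT
    · rw [min_eq_left hcT] at h
      have hlt : Real.exp (-t * c) < 1 := by
        rw [Real.exp_lt_one_iff]
        have : (0 : ℝ) < c := by exact_mod_cast hc1
        nlinarith
      have := Real.log_le_log (by linarith) (sub_le_sub_left h 1)
      have := Real.exp_pos (-t * T)
      linarith
    · rw [min_eq_right (by omega)] at h
      have := neg_log_one_sub_le (hq0 c) (h.trans hT)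
      linarith
  have hnn : ∀ c, 0 < c → 0 ≤ -Real.log (1 - Real.exp (-t * (c : ℕ))) := fun c hc => by
    have hlt : Real.exp (-t * c) < 1 := by
      rw [Real.exp_lt_one_iff]
      have : (0 : ℝ) < c := by exact_mod_cast hc
      nlinarith
    have := Real.log_nonpos (by linarith) (sub_le_self 1 (Real.exp_pos (-t * c)).le)
    linarith
  refine (Finset.sum_le_sum hterm).trans ?_
  rw [Finset.sum_add_distrib, ← Finset.sum_filter, Finset.sum_const, Nat.card_Icc,
    Nat.add_sub_cancel, nsmul_eq_mul]
  refine add_le_add_left (le_trans ?_ (sum_neg_log_one_sub_exp_le ht T)) _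
  refine Finset.sum_le_sum_of_subset_of_nonneg (fun c hc => ?_) fun c hc _ =>
    hnn c (Finset.mem_Icc.mp hc).1
  simp only [Finset.mem_filter, Finset.mem_Icc] at hc ⊢
  omega

/-! ### Rankin's method. -/

theorem exponentMultiplicity_eq_zero {n c : ℕ} (h : ∀ p ∈ n.primeFactors, n.factorization p ≠ c) :
    exponentMultiplicity n c = 0 :=
  Finset.card_eq_zero.mpr (Finset.filter_eq_empty_iff.mpr h)

theorem factorization_pos_of_mem {n p : ℕ} (hp : p ∈ n.primeFactors) : 1 ≤ n.factorization p :=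
  (Nat.prime_of_mem_primeFactors hp).factorization_pos_of_dvd
    (Nat.mem_primeFactors.mp hp).2.2 (Nat.dvd_of_mem_primeFactors hp)

/-- Rankin's method for the number of values of `f` up to `x`. -/
theorem ncard_factorizationValues_le {x : ℝ} {r M T : ℕ} {s w : ℝ} (hx : 1 ≤ x) (hs : 0 < s)
    (hw : 0 < w)
    (hC : ∀ c : ℕ, 1 ≤ c → Real.exp (w * (min c T : ℕ)) ≤ ((r + c - 1).choose c : ℝ))
    (hM : ∀ c : ℕ, ((r + c - 1).choose c : ℝ) ≤ r.factorial * x → c ≤ M)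
    (hT : Real.exp (-(s * w) * T) ≤ 1 / 2) :
    ((factorizationValues x).ncard : ℝ) ≤ Real.exp (s * Real.log (r.factorial * x) +
      (Real.pi ^ 2 / (6 * (s * w)) + M * (2 * Real.exp (-(s * w) * T)))) := by
  classical
  have hT0 : 1 ≤ T := by
    rcases Nat.eq_zero_or_pos T with rfl | h
    · norm_num at hT
    · exact h
  set B : ℝ := r.factorial * x with hB
  have hBpos : 0 < B := mul_pos (by exact_mod_cast r.factorial_pos) (by linarith)
  let C : ℕ → ℝ := fun c => ((r + c - 1).choose c : ℝ)
  have hCpos : ∀ c, 1 ≤ c → 0 < C c := fun c hc => (Real.exp_pos _).trans_le (hC c hc)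
  have hC1 : ∀ c, 1 ≤ c → 1 ≤ C c := fun c hc => by
    have := hCpos c hc
    simp only [C] at this ⊢
    exact_mod_cast this
  let q : ℕ → ℝ := fun c => C c ^ (-s)
  have hq0 : ∀ c, 0 ≤ q c := fun c => Real.rpow_nonneg (Nat.cast_nonneg _) _
  have hq : ∀ c, 1 ≤ c → q c ≤ Real.exp (-(s * w) * (min c T : ℕ)) := fun c hc => by
    refine (Real.rpow_le_rpow_of_nonpos (Real.exp_pos _) (hC c hc) (by linarith)).trans_eq ?_
    rw [← Real.exp_mul]
    congr 1
    ring
  have hq1 : ∀ c, 1 ≤ c → q c < 1 := fun c hc => by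
    refine (hq c hc).trans_lt ?_
    rw [Real.exp_lt_one_iff]
    have : (0 : ℝ) < (min c T : ℕ) := by exact_mod_cast lt_min hc hT0
    have := mul_pos (mul_pos hs hw) this
    linarith
  have hprod : ∀ n, 0 < n → (numFactorizations n : ℝ) ≤ x →
      ∏ p ∈ n.primeFactors, C (n.factorization p) ≤ B := by
    intro n hn hnx
    have h := prod_choose_le_factorial_mul_numFactorizations hn r
    have h' : ∏ p ∈ n.primeFactors, C (n.factorization p) ≤
        r.factorial * (numFactorizations n : ℝ) := by
      simp only [C]
      exact_mod_cast h
    exact h'.trans (mul_le_mul_of_nonneg_left hnx (Nat.cast_nonneg _))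
  have hexp : ∀ n, 0 < n → (numFactorizations n : ℝ) ≤ x →
      ∀ p ∈ n.primeFactors, n.factorization p ∈ Finset.Icc 1 M := by
    intro n hn hnx p hp
    refine Finset.mem_Icc.mpr ⟨factorization_pos_of_mem hp, hM _ ?_⟩
    refine le_trans ?_ (hprod n hn hnx)
    rw [← Finset.mul_prod_erase _ _ hp]
    refine le_mul_of_one_le_right (Nat.cast_nonneg _) ?_
    refine Finset.one_le_prod fun i hi => ?_
    exact hC1 _ (factorization_pos_of_mem (Finset.mem_of_mem_erase hi))
  -- The right side is `(B / ∏ C) ^ s`, so every admissible exponent pattern has weight at least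
  -- `1`.
  have hweight : ∀ n, 0 < n → (numFactorizations n : ℝ) ≤ x →
      1 ≤ B ^ s * ∏ c ∈ Finset.Icc 1 M, q c ^ exponentMultiplicity n c := by
    intro n hn hnx
    have h1 : ∏ c ∈ Finset.Icc 1 M, q c ^ exponentMultiplicity n c =
        (∏ p ∈ n.primeFactors, C (n.factorization p)) ^ (-s) := by
      rw [← Real.finsetProd_rpow _ _ fun i _ => Nat.cast_nonneg _,
        ← Finset.prod_fiberwise_of_maps_to' (hexp n hn hnx) q]
      simp only [Finset.prod_const, exponentMultiplicity]
    have hpos : 0 < ∏ p ∈ n.primeFactors, C (n.factorization p) :=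
      Finset.prod_pos fun p hp => hCpos _ (factorization_pos_of_mem hp)
    have h2 := Real.rpow_le_rpow_of_nonpos hpos (hprod n hn hnx) (neg_nonpos.mpr hs.le)
    rw [h1]
    calc (1 : ℝ) = B ^ s * B ^ (-s) := by rw [← Real.rpow_add hBpos]; simp
      _ ≤ _ := mul_le_mul_of_nonneg_left h2 (Real.rpow_nonneg hBpos.le _)
  have hV : ∀ v ∈ (factorizationValues_finite x).toFinset,
      ∃ n : ℕ, 0 < n ∧ numFactorizations n = v ∧ (numFactorizations n : ℝ) ≤ x := by
    intro v hv
    obtain ⟨n, hn, hnv, hvx⟩ := (Set.Finite.mem_toFinset _).mp hv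
    exact ⟨n, hn, hnv, hnv ▸ hvx⟩
  choose! N hN0 hNv hNx using hV
  -- With one representative `N v` chosen per value, distinct values have distinct exponent
  -- patterns.
  have hinj : Set.InjOn (fun v => exponentMultiplicity (N v))
      (factorizationValues_finite x).toFinset := by
    intro v hv v' hv' h
    rw [← hNv v hv, ← hNv v' hv']
    exact numFactorizations_eq_of_exponentMultiplicity (hN0 v hv) (hN0 v' hv') h
  have hbound : ((factorizationValues x).ncard : ℝ) ≤
      B ^ s * ∏ c ∈ Finset.Icc 1 M, (1 - q c)⁻¹ := by
    rw [Set.ncard_eq_toFinset_card _ (factorizationValues_finite x),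
      ← Finset.card_image_of_injOn hinj, Finset.cast_card]
    refine (Finset.sum_le_sum (g := fun σ : ℕ → ℕ =>
      B ^ s * ∏ c ∈ Finset.Icc 1 M, q c ^ σ c) fun σ hσ => ?_).trans ?_
    · obtain ⟨v, hv, rfl⟩ := Finset.mem_image.mp hσ
      exact hweight _ (hN0 v hv) (hNx v hv)
    rw [← Finset.mul_sum]
    refine mul_le_mul_of_nonneg_left ?_ (Real.rpow_nonneg hBpos.le _)
    refine sum_prod_pow_le_prod_inv_one_sub _ _ (fun σ hσ c hc => ?_) q (fun c _ => hq0 c)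
      fun c hc => hq1 c (Finset.mem_Icc.mp hc).1
    obtain ⟨v, hv, rfl⟩ := Finset.mem_image.mp hσ
    exact exponentMultiplicity_eq_zero fun p hp h => hc (h ▸ hexp _ (hN0 v hv) (hNx v hv) p hp)
  refine hbound.trans ?_
  rw [Real.exp_add, Real.rpow_def_of_pos hBpos, mul_comm (Real.log B)]
  refine mul_le_mul_of_nonneg_left ?_ (Real.exp_pos _).le
  refine le_trans (le_of_eq ?_) (Real.exp_le_exp.mpr
    (sum_neg_log_one_sub_le (M := M) (mul_pos hs hw) hq0 hq hT))
  rw [Real.exp_sum]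
  refine Finset.prod_congr rfl fun c hc => ?_
  rw [Real.exp_neg, Real.exp_log]
  have := hq1 c (Finset.mem_Icc.mp hc).1
  linarith

/-! ### Binomial estimates and choice of parameters. -/

theorem div_pow_le_choose (m k : ℕ) :
    (((m : ℝ) + 1) / k) ^ k ≤ ((m + k).choose k : ℝ) := by
  have h := Nat.pow_le_choose (α := ℝ) k (m + k)
  rw [show m + k + 1 - k = m + 1 by omega] at h
  refine le_trans ?_ h
  rw [div_pow]
  have h1 : ((k.factorial : ℕ) : ℝ) ≤ (k : ℝ) ^ k := by exact_mod_cast Nat.factorial_le_pow k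
  have h2 : (0 : ℝ) < k.factorial := by exact_mod_cast k.factorial_pos
  push_cast
  gcongr

/-- This bounds the size of a single exponent `c`, with `m` fixed and `c` large; `div_pow_le_choose`
serves the range where `k` is small compared with `m`. -/
theorem pow_le_factorial_mul_choose (m c : ℕ) :
    ((c : ℝ) + 1) ^ m ≤ m.factorial * ((m + c).choose c : ℝ) := by
  have h := Nat.pow_le_choose (α := ℝ) m (m + c)
  rw [show m + c + 1 - m = c + 1 by omega, Nat.choose_symm_add, div_le_iff₀' (by
    exact_mod_cast m.factorial_pos)] at h
  exact_mod_cast h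

theorem choose_add_le_choose_add (m : ℕ) {k c : ℕ} (h : k ≤ c) :
    (m + k).choose k ≤ (m + c).choose c := by
  rw [← Nat.choose_symm_add, ← Nat.choose_symm_add]
  exact Nat.choose_le_choose m (by omega)

theorem log_factorial_le {r : ℕ} {L : ℝ} (hr : 1 ≤ r) (h : (r : ℝ) ≤ Real.exp L) :
    Real.log r.factorial ≤ r * L := by
  have hr0 : (0 : ℝ) < r := by exact_mod_cast hr
  have h1 : ((r.factorial : ℕ) : ℝ) ≤ (r : ℝ) ^ r := by exact_mod_cast Nat.factorial_le_pow r
  calc Real.log r.factorial ≤ Real.log ((r : ℝ) ^ r) :=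
        Real.log_le_log (by exact_mod_cast r.factorial_pos) h1
    _ = r * Real.log r := Real.log_pow _ _
    _ ≤ r * L := by
        gcongr
        exact (Real.log_le_iff_le_exp hr0).mpr h

/-- Numerically `0.77 + 0.8 = 1.57`, while `2 * √(2/3) ≥ 1.62`; the difference `0.05 * π * R`
exceeds the leftover `1` once `R ≥ 10`. -/
theorem exponent_le {R a b : ℝ} (hR : 10 ≤ R) (ha : a ≤ 0.77 * Real.pi * R) (hb : b ≤ 1) :
    a + (Real.pi ^ 2 / (6 * (0.21 * Real.pi / R)) + b) ≤
      2 * Real.pi * Real.sqrt (2 / 3) * R := by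
  have hpi := Real.pi_gt_three
  have hRpos : 0 < R := by linarith
  have h1 : Real.pi ^ 2 / (6 * (0.21 * Real.pi / R)) ≤ 0.8 * (Real.pi * R) := by
    rw [div_le_iff₀ (by positivity), show 0.8 * (Real.pi * R) * (6 * (0.21 * Real.pi / R)) =
      1.008 * Real.pi ^ 2 by field_simp; ring]
    exact le_mul_of_one_le_left (sq_nonneg _) (by norm_num)
  have h2 : (0.81 : ℝ) ≤ Real.sqrt (2 / 3) := Real.le_sqrt_of_sq_le (by norm_num)
  have h3 : 0 < Real.pi * R := by positivity
  have h4 : 1.62 * (Real.pi * R) ≤ 2 * Real.pi * Real.sqrt (2 / 3) * R := by nlinarith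
  have h5 : 30 ≤ Real.pi * R := by nlinarith
  linarith

/-- The bound for `#𝓕(x)`, in terms of `L = log (log x)`. -/
theorem ncard_factorizationValues_exp_exp_le {L : ℝ} (hL : 10 ≤ L)
    (h : 20 * L ^ 2 ≤ Real.exp (0.03 * L)) :
    ((factorizationValues (Real.exp (Real.exp L))).ncard : ℝ) ≤
      Real.exp (2 * Real.pi * Real.sqrt (2 / 3) * Real.sqrt (Real.exp L / L)) := by
  have hL0 : 0 < L := by linarith
  set X := Real.exp L with hX
  have hXpos : 0 < X := Real.exp_pos L
  -- The number of slots is `r = m + 1 = ⌊Y⌋`: small enough that `log r! ≤ r * L ≤ X / L` is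
  -- negligible, yet at least `exp (0.97 * L)`.
  set Y := X / L ^ 2 with hY
  have hXY : X = L ^ 2 * Y := by rw [hY]; field_simp
  have hYexp : 20 * Real.exp (0.97 * L) ≤ Y := by
    rw [hY, le_div_iff₀ (by positivity)]
    calc 20 * Real.exp (0.97 * L) * L ^ 2 = Real.exp (0.97 * L) * (20 * L ^ 2) := by ring
      _ ≤ Real.exp (0.97 * L) * Real.exp (0.03 * L) := by gcongr
      _ = X := by rw [← Real.exp_add, hX]; congr 1; ring
  have hexp1 : 1 ≤ Real.exp (0.97 * L) := Real.one_le_exp (by positivity)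
  have hY20 : 20 ≤ Y := by linarith
  obtain ⟨m, hm⟩ : ∃ m, ⌊Y⌋₊ = m + 1 :=
    Nat.exists_eq_succ_of_ne_zero (Nat.floor_pos.mpr (by linarith)).ne'
  have hmY : (m : ℝ) + 1 ≤ Y := by
    have := Nat.floor_le (show 0 ≤ Y by linarith)
    rw [hm] at this
    exact_mod_cast this
  have hYm : Y < (m : ℝ) + 2 := by
    have := Nat.lt_floor_add_one Y
    rw [hm] at this
    push_cast at this
    linarith
  have hYX : Y ≤ X := div_le_self hXpos.le (by nlinarith)
  have hlogfac : Real.log ((m + 1).factorial : ℕ) ≤ 0.1 * X := by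
    refine (log_factorial_le (by omega) (L := L) (by push_cast; linarith)).trans ?_
    push_cast
    nlinarith
  -- For `k ≤ T` the binomial is at least `((m + 1) / k) ^ k`, and `0.97 - 2/3 > 0.3` yields `w =
  -- 0.3 * L`. The exponent `2/3` exceeds `1/2`, so `T` dominates `R` and the tail is small.
  set T := ⌊Real.exp (2 / 3 * L)⌋₊ with hT
  set M := ⌊Real.exp (2 * L ^ 2)⌋₊ with hM
  set R := Real.sqrt (X / L) with hR
  have hRpos : 0 < R := Real.sqrt_pos.mpr (by positivity)
  have hR2 : R ^ 2 * L = X := by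
    rw [hR, Real.sq_sqrt (by positivity)]
    field_simp
  have hTle : (T : ℝ) ≤ Real.exp (2 / 3 * L) := Nat.floor_le (Real.exp_pos _).le
  have hTge : Real.exp (2 / 3 * L) / 2 ≤ T := by
    have h1 := Nat.lt_floor_add_one (Real.exp (2 / 3 * L))
    have h2 := Real.add_one_le_exp (2 / 3 * L)
    rw [← hT] at h1
    linarith
  have hT1 : 1 ≤ T := by
    have : (0 : ℝ) < T := lt_of_lt_of_le (by positivity) hTge
    exact_mod_cast this
  have hpi := Real.pi_gt_three
  -- This nearly balances the two main terms: `s * 1.1 * X = 0.77 * π * R` and `π ^ 2 / (6 * s * w)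
  -- ≈ 0.794 * π * R`.
  set s := 0.7 * Real.pi / (L * R) with hs
  have hspos : 0 < s := by positivity
  have hsw : s * (0.3 * L) = 0.21 * Real.pi / R := by rw [hs]; field_simp; norm_num
  have hsX : s * X = 0.7 * Real.pi * R := by rw [hs, ← hR2]; field_simp
  have hRle : R ≤ Real.exp (1 / 2 * L) := by
    refine Real.sqrt_le_iff.mpr ⟨(Real.exp_pos _).le, ?_⟩
    rw [← Real.exp_nat_mul, show ((2 : ℕ) : ℝ) * (1 / 2 * L) = L by push_cast; ring]
    exact div_le_self hXpos.le (by linarith)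
  -- The term `2 * L ^ 2` cancels the count `M ≤ exp (2 * L ^ 2)`, and the extra `1` beats the
  -- factor `2`.
  have htail : 2 * L ^ 2 + 1 ≤ s * (0.3 * L) * T := by
    have h1 : R * Real.exp (0.03 * L) ≤ Real.exp (2 / 3 * L) := by
      calc R * Real.exp (0.03 * L) ≤ Real.exp (1 / 2 * L) * Real.exp (0.03 * L) := by gcongr
        _ = Real.exp (1 / 2 * L + 0.03 * L) := (Real.exp_add _ _).symm
        _ ≤ _ := Real.exp_le_exp.mpr (by linarith)
    rw [hsw, div_mul_eq_mul_div, le_div_iff₀ hRpos]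
    have h2 : R * (20 * L ^ 2) ≤ R * Real.exp (0.03 * L) := by gcongr
    have h3 : (0.3 : ℝ) * T ≤ 0.21 * Real.pi * T := by
      have : (0 : ℝ) < T := by exact_mod_cast hT1
      nlinarith
    have h4 : R ≤ R * L ^ 2 := le_mul_of_one_le_right hRpos.le (by nlinarith)
    linarith
  have hlog2 : Real.exp (-1) ≤ 1 / 2 := by
    rw [Real.exp_neg, one_div]
    exact inv_anti₀ (by norm_num) (by have := Real.add_one_le_exp (1 : ℝ); linarith)
  have hMT : M * (2 * Real.exp (-(s * (0.3 * L)) * T)) ≤ 1 := by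
    calc M * (2 * Real.exp (-(s * (0.3 * L)) * T))
        ≤ Real.exp (2 * L ^ 2) * (2 * Real.exp (-(2 * L ^ 2) + -1)) := by
          have : -(s * (0.3 * L)) * T ≤ -(2 * L ^ 2) + -1 := by linarith
          have hMle : (M : ℝ) ≤ Real.exp (2 * L ^ 2) := Nat.floor_le (Real.exp_pos _).le
          gcongr
      _ = 2 * Real.exp (-1) := by
          rw [Real.exp_add, Real.exp_neg (2 * L ^ 2)]
          field_simp
      _ ≤ 1 := by linarith
  have hx : 1 ≤ Real.exp X := Real.one_le_exp hXpos.le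
  have hlogB : Real.log ((m + 1).factorial * Real.exp X) ≤ 1.1 * X := by
    rw [Real.log_mul (by exact_mod_cast (m + 1).factorial_ne_zero) (Real.exp_pos _).ne',
      Real.log_exp]
    linarith
  refine (ncard_factorizationValues_le (r := m + 1) (M := M) (T := T) (s := s) (w := 0.3 * L)
    hx hspos (by positivity) ?_ ?_ ?_).trans ?_
  · intro c hc
    rw [show m + 1 + c - 1 = m + c by omega]
    have hk : 1 ≤ min c T := le_min hc hT1
    have hk0 : (0 : ℝ) < (min c T : ℕ) := by exact_mod_cast hk
    refine le_trans ?_ (Nat.cast_le.mpr (choose_add_le_choose_add m (min_le_left c T)))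
    refine le_trans ?_ (div_pow_le_choose m _)
    rw [mul_comm, Real.exp_nat_mul]
    refine pow_le_pow_left₀ (Real.exp_pos _).le ?_ _
    rw [le_div_iff₀ hk0]
    have hkT : ((min c T : ℕ) : ℝ) ≤ Real.exp (2 / 3 * L) :=
      (Nat.cast_le.mpr (min_le_right c T)).trans hTle
    calc Real.exp (0.3 * L) * (min c T : ℕ) ≤ Real.exp (0.3 * L) * Real.exp (2 / 3 * L) := by
          gcongr
      _ = Real.exp (0.3 * L + 2 / 3 * L) := (Real.exp_add _ _).symm
      _ ≤ Real.exp (0.97 * L) := Real.exp_le_exp.mpr (by linarith)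
      _ ≤ m + 1 := by linarith
  · intro c hc
    rw [show m + 1 + c - 1 = m + c by omega] at hc
    have hm0 : (0 : ℝ) < m := by linarith
    have h1 : ((c : ℝ) + 1) ^ m ≤ (m + 1).factorial * ((m + 1).factorial * Real.exp X) := by
      refine (pow_le_factorial_mul_choose m c).trans ?_
      have : ((m.factorial : ℕ) : ℝ) ≤ (m + 1).factorial := by
        exact_mod_cast Nat.factorial_le (Nat.le_succ m)
      gcongr
    have hfac : (0 : ℝ) < (m + 1).factorial := by exact_mod_cast (m + 1).factorial_pos
    have h2 := Real.log_le_log (by positivity) h1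
    rw [Real.log_pow, Real.log_mul hfac.ne' (by positivity)] at h2
    -- The total `1.2 * X` is `X` from `x` plus `0.1 * X` from each of the two factorials; `Y < m +
    -- 2` and `Y ≥ 20` then give `1.2 * Y ≤ 2 * m`.
    have h3 : m * Real.log ((c : ℝ) + 1) ≤ m * (2 * L ^ 2) := by
      calc m * Real.log ((c : ℝ) + 1) ≤ 1.2 * X := by linarith
        _ = L ^ 2 * (1.2 * Y) := by rw [hXY]; ring
        _ ≤ L ^ 2 * (m * 2) := by
            refine mul_le_mul_of_nonneg_left ?_ (sq_nonneg L)
            linarith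
        _ = m * (2 * L ^ 2) := by ring
    have h4 := le_of_mul_le_mul_left h3 hm0
    refine Nat.le_floor ?_
    have h5 := (Real.log_le_iff_le_exp (by positivity)).mp h4
    linarith
  · refine le_trans (Real.exp_le_exp.mpr ?_) hlog2
    rw [neg_mul]
    exact neg_le_neg (le_trans (le_add_of_nonneg_left (by positivity)) htail)
  · have hR10 : 10 ≤ R := Real.le_sqrt_of_sq_le (by rw [le_div_iff₀ hL0]; nlinarith)
    refine Real.exp_le_exp.mpr ?_
    rw [hsw] at hMT ⊢
    refine exponent_le hR10 ?_ hMT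
    calc _ ≤ s * (1.1 * X) := by gcongr
      _ = 1.1 * (s * X) := by ring
      _ = _ := by rw [hsX]; ring

/-- The bound for `#𝓕(x)` without any error term; the constant `2π√(2/3)` leaves enough room to
absorb it. -/
theorem eventually_ncard_factorizationValues_le :
    ∀ᶠ x : ℝ in Filter.atTop, ((factorizationValues x).ncard : ℝ) ≤
      Real.exp (2 * Real.pi * Real.sqrt (2 / 3) *
        Real.sqrt (Real.log x / Real.log (Real.log x))) := by
  have hloglog : Filter.Tendsto (fun x => Real.log (Real.log x)) Filter.atTop Filter.atTop :=
    Real.tendsto_log_atTop.comp Real.tendsto_log_atTop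
  have hev : ∀ᶠ L : ℝ in Filter.atTop, 20 * L ^ 2 ≤ Real.exp (0.03 * L) := by
    have ho := (isLittleO_pow_exp_pos_mul_atTop 2 (show (0 : ℝ) < 0.03 by norm_num)).def
      (show (0 : ℝ) < 1 / 20 by norm_num)
    filter_upwards [ho] with L hL
    rw [Real.norm_of_nonneg (sq_nonneg L), Real.norm_of_nonneg (Real.exp_pos _).le] at hL
    linarith
  filter_upwards [hloglog.eventually hev, hloglog.eventually_ge_atTop 10,
    Real.tendsto_log_atTop.eventually_gt_atTop 0, Filter.eventually_gt_atTop 0]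
    with x h1 h2 h3 h4
  have := ncard_factorizationValues_exp_exp_le h2 h1
  rwa [Real.exp_log h3, Real.exp_log h4] at this

theorem theorem1 :
    ∃ E : ℝ → ℝ,
      Asymptotics.IsBigO Filter.atTop E
        (fun x : ℝ => Real.log (Real.log (Real.log x)) / Real.log (Real.log x)) ∧
      ∀ᶠ x : ℝ in Filter.atTop,
        ((factorizationValues x).ncard : ℝ) ≤
          Real.exp ((2 * Real.pi * Real.sqrt (2 / 3)) *
            Real.sqrt (Real.log x / Real.log (Real.log x)) * (1 + E x)) := by
  refine ⟨fun _ => 0, Asymptotics.isBigO_zero _ _, ?_⟩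
  simpa only [add_zero, mul_one] using eventually_ncard_factorizationValues_le
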